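/- Work in a $dq$ frame rotating at frequency $\omega_0>0$ and put $\mathcal J=\begin{bmatrix}0&1\\-1&0\end{bmatrix}$. *Strict passivity.* A system $\dot x=f(x,u)$, $y=h(x)$ is strictly passive at $(x^*,u^*)$ on an open set $\mathcal X\ni x^*$ with storage function $S$ if $S$ is $C^1$ on $\mathcal X$, $S(x^*)=0$, $S(x)>0$ for $x\in\mathcal X\setminus\{x^*\}$, and $$\nabla S(x)^\top f(x,u)<(h(x)-h(x^*))^\top(u-u^*)\qquad\text{for all }x\in\mathcal X\setminus\{x^*\}\text{ and all }u .$$ *Microgrid.* Consider finitely many DGU nodes, load nodes and lines in an arbitrary topology, described by the bipartite graph of nodes and lines in which every line $e$ is adjacent to its two end nodes $s(e)$ and $t(e)$; every load node is adjacent to at least one line. For a node $n$ with voltage $V_n\in\mathbb R^2$ let $d_n=-\sum_{s(e)=n}I_e+\sum_{t(e)=n}I_e+w_n$ be the current entering it, where $w_n$ is an external current injection ($w=0$ for the isolated microgrid). * *$\pi$-model lines* with $R_e,L_e,C_e>0$, where $C_e$ is the shunt capacitance at each end, and state $L_eI_e$: $L_e\dot I_e=\omega_0L_e\mathcal JI_e-R_eI_e+V_{s(e)}-V_{t(e)}$.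 * *Load nodes* with state $C_bV_b$, where $C_b$ is the sum of the shunt capacitances of the line ends at $b$: $C_b\dot V_b=\omega_0C_b\mathcal JV_b-I_b(V_b)+d_b$. For $V=(V_d,V_q)\ne0$ and $v=\|V\|_2$, the load current is $I_b(V)=\frac1{v^2}\begin{bmatrix}P(v)&Q(v)\\-Q(v)&P(v)\end{bmatrix}V$, with either $P(v)=Y_pv^2+I_pv+P_p$, $Q(v)=Y_qv^2+I_qv+P_q$ (ZIP) or $P(v)=P_0(v/V_0)^{n_p}$, $Q(v)=Q_0(v/V_0)^{n_q}$ (exponential), where all parameters are nonnegative and $V_0>0$. * *Controlled DGUs* with state $x_i=(L_{ti}I_i,C_{ti}V_i)\in\mathbb R^4$, $L_{ti},C_{ti}>0$, and set point $x_i^*=(L_{ti}I_i^*,C_{ti}V_i^*)$: the closed loop is a port-Hamiltonian system $\dot\epsilon=J_i(\epsilon)\nabla H_i(\epsilon)-\mathcal R_i(\epsilon)+K(d_i-d_i^*)$ in the error $\epsilon=x_i-x_i^*$, on a set $\mathcal D_i\subset\mathbb R^4$ of errors, where $J_i(\epsilon)$ is skew-symmetric, $K=\begin{bmatrix}0\\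 \mathbb I_2\end{bmatrix}$, $H_i$ is $C^2$, and $J_i$, $\mathcal R_i$ are $C^1$. Let line currents $I_e^*$, load voltages $V_b^*$ and the DGU set points $x_i^*$ be such that every line, DGU and load is in equilibrium when its port variables have the values imposed by its neighbours with $w=0$ (in particular, $d_i^*$ is the exchange current into DGU $i$ for the line currents $I_e^*$). For each load node let $U_b\subset\mathbb R^2\setminus\{0\}$ be open with $V_b^*\in U_b$. Suppose that * the error system of every DGU, with output $V_i-V_i^*$ and input $d_i-d_i^*$, is strictly passive at zero on $\mathcal D_i$ with storage function $H_i(\epsilon)-H_i(0)$; * the error system of every load, $C_b\dot{\tilde V}_b=\omega_0C_b\mathcal J\tilde V_b-(I_b(V_b^*+\tilde V_b)-I_b(V_b^*))+(d_b-d_b^*)$ with state $C_b\tilde V_b=C_b(V_b-V_b^*)$ and output $\tilde V_b$, is strictly passive at zero on $\{V_b\in U_b\}$ with storage function $\frac{C_b}2\|\tilde V_b\|^2$. Then the whole microgrid, with input $w$ and output the vector of all node voltages, is strictly passive at the combined state $x_M^*=\big((L_eI_e^*)_e,(x_i^*)_i,(C_bV_b^*)_b\big)$ and $w=0$, on the set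 of states with $x_i-x_i^*\in\mathcal D_i$ and $V_b\in U_b$ for all $i,b$. Its storage function is the sum of $\frac{L_e}2\|I_e-I_e^*\|^2$ over the lines, $H_i(x_i-x_i^*)-H_i(0)$ over the DGUs and $\frac{C_b}2\|V_b-V_b^*\|^2$ over the loads. Moreover, $x_M^*$ is an asymptotically stable equilibrium of the isolated microgrid ($w=0$): solutions starting close to $x_M^*$ exist for all $t\ge0$, $x_M^*$ is Lyapunov stable, and solutions starting close to $x_M^*$ converge to it. -/

import Mathlib

open scoped Matrix Topology

noncomputable section

namespace ACMicrogrid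

/-! Port-Hamiltonian systems, strict passivity, asymptotic stability -/

/-- The gradient of a function on `ℝⁿ`, as the vector of its partial derivatives. -/
def grad {n : ℕ} (H : (Fin n → ℝ) → ℝ) (x : Fin n → ℝ) : Fin n → ℝ :=
  fun k => fderiv ℝ H x (Pi.single k 1)

/-- A port-Hamiltonian system with `n` states, `m` port variables and a (possibly nonlinear)
resistive structure `R`:
`x' = J(x) ∇H(x) - R(x) + G u`, `y = Gᵀ ∇H(x)`, with `J(x)` skew-symmetric. -/
structure PHS (n m : ℕ) where
  J : (Fin n → ℝ) → Matrix (Fin n) (Fin n) ℝ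
  skew : ∀ x, (J x)ᵀ = -(J x)
  R : (Fin n → ℝ) → (Fin n → ℝ)
  G : Matrix (Fin n) (Fin m) ℝ
  H : (Fin n → ℝ) → ℝ

/-- Right-hand side of the state equation. -/
def PHS.f {n m : ℕ} (S : PHS n m) (x : Fin n → ℝ) (u : Fin m → ℝ) : Fin n → ℝ :=
  S.J x *ᵥ grad S.H x - S.R x + S.G *ᵥ u

/-- Power-conjugated output. -/
def PHS.y {n m : ℕ} (S : PHS n m) (x : Fin n → ℝ) : Fin m → ℝ :=
  S.Gᵀ *ᵥ grad S.H x

/-- The system `x' = f x u`, `y = h x` is strictly passive at `(xs, us)` on the open region `U`,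
with storage function `S` and supply rate `(y - ys)ᵀ (u - us)`: the storage function is
continuously differentiable and positive definite about `xs`, and away from `xs` its rate of change
along the system is strictly smaller than the supply rate, for every input. -/
structure StrictlyPassiveOn {X : Type*} [NormedAddCommGroup X] [NormedSpace ℝ X]
    {ι : Type*} [Fintype ι] (f : X → (ι → ℝ) → X) (h : X → ι → ℝ) (S : X → ℝ)
    (U : Set X) (xs : X) (us : ι → ℝ) : Prop where
  isOpen : IsOpen U
  mem : xs ∈ U
  contDiffOn : ContDiffOn ℝ 1 S U
  storage_eq : S xs = 0
  storage_pos : ∀ x ∈ U, x ≠ xs → 0 < S x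
  dissipation : ∀ x ∈ U, x ≠ xs → ∀ u, fderiv ℝ S x (f x u) < (h x - h xs) ⬝ᵥ (u - us)

/-- `γ` solves `x' = g x` on the time set `s`. -/
def IsSolutionOn {X : Type*} [NormedAddCommGroup X] [NormedSpace ℝ X]
    (g : X → X) (γ : ℝ → X) (s : Set ℝ) : Prop :=
  ∀ t ∈ s, HasDerivWithinAt γ (g (γ t)) s t

/-- `xs` is an asymptotically stable equilibrium of `x' = g x`: an equilibrium, solutions from
nearby initial states exist for all times `t ≥ 0`, `xs` is stable in the sense of Lyapunov, and it
attracts the solutions that start nearby. -/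
structure IsAsymptoticallyStable {X : Type*} [NormedAddCommGroup X] [NormedSpace ℝ X]
    (g : X → X) (xs : X) : Prop where
  equilibrium : g xs = 0
  exists_solution : ∃ r > 0, ∀ x₀ ∈ Metric.ball xs r,
    ∃ γ : ℝ → X, γ 0 = x₀ ∧ IsSolutionOn g γ (Set.Ici 0)
  stable : ∀ ε > 0, ∃ δ > 0, ∀ (γ : ℝ → X) (T : ℝ), γ 0 ∈ Metric.ball xs δ →
    IsSolutionOn g γ (Set.Ico 0 T) → ∀ t ∈ Set.Ico 0 T, γ t ∈ Metric.ball xs ε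
  attractive : ∃ r > 0, ∀ γ : ℝ → X, γ 0 ∈ Metric.ball xs r →
    IsSolutionOn g γ (Set.Ici 0) → Filter.Tendsto γ Filter.atTop (𝓝 xs)

/-- A vector in `dq` coordinates. -/
abbrev DQ : Type := Fin 2 → ℝ

/-- The matrix with entries `0, a, -a, 0` of the rotating `dq` frame. -/
def rotMatrix (a : ℝ) : Matrix (Fin 2) (Fin 2) ℝ := !![0, a; -a, 0]

theorem rotMatrix_skew (a : ℝ) : (rotMatrix a)ᵀ = -(rotMatrix a) := by
  ext i j
  fin_cases i <;> fin_cases j <;> simp [rotMatrix]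

/-! Electrical lines -/

/-- A `π`-model line: series resistance `R`, series inductance `L`, and a shunt capacitance `C`
at each of its two ends. -/
structure PiLine where
  R : ℝ
  L : ℝ
  C : ℝ
  R_pos : 0 < R
  L_pos : 0 < L
  C_pos : 0 < C

/-- The series branch of a line, with state `x = L I`, driven by the voltage difference between
its ends: `L I' = ω₀ L (I_q, -I_d) - R I + u`. The shunt capacitances belong to the end nodes. -/
def PiLine.phs (l : PiLine) (ω₀ : ℝ) : PHS 2 2 where
  J := fun _ => rotMatrix (ω₀ * l.L)
  skew := fun _ => rotMatrix_skew _
  R := fun x => (l.R / l.L) • x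
  G := 1
  H := fun x => 1 / 2 * (x ⬝ᵥ (l.L⁻¹ • x))

/-! Nonlinear static loads -/

/-- Amplitude (2-norm) of a `dq` voltage vector. -/
def amplitude (V : DQ) : ℝ := √(V 0 ^ 2 + V 1 ^ 2)

/-- A nonlinear static load: a ZIP load with (grouped) admittance, current and power parameters,
or an exponential load with nominal powers `P₀, Q₀`, nominal voltage `V₀` and voltage indexes
`np, nq`. -/
inductive Load where
  | zip (Yp Yq Ip Iq Pp Pq : ℝ) (hYp : 0 ≤ Yp) (hYq : 0 ≤ Yq) (hIp : 0 ≤ Ip) (hIq : 0 ≤ Iq)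
      (hPp : 0 ≤ Pp) (hPq : 0 ≤ Pq) : Load
  | exponential (P₀ Q₀ V₀ np nq : ℝ) (hP : 0 ≤ P₀) (hQ : 0 ≤ Q₀) (hV : 0 < V₀) (hnp : 0 ≤ np)
      (hnq : 0 ≤ nq) : Load

/-- Active power consumed at voltage amplitude `v`. -/
def Load.activePower : Load → ℝ → ℝ
  | .zip Yp _ Ip _ Pp _ _ _ _ _ _ _, v => Yp * v ^ 2 + Ip * v + Pp
  | .exponential P₀ _ V₀ np _ _ _ _ _ _, v => P₀ * (v / V₀) ^ np

/-- Reactive power consumed at voltage amplitude `v`. -/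
def Load.reactivePower : Load → ℝ → ℝ
  | .zip _ Yq _ Iq _ Pq _ _ _ _ _ _, v => Yq * v ^ 2 + Iq * v + Pq
  | .exponential _ Q₀ V₀ _ nq _ _ _ _ _, v => Q₀ * (v / V₀) ^ nq

/-- The load current as a function of the load voltage (meaningful for `V ≠ 0`). -/
def Load.current (l : Load) (V : DQ) : DQ :=
  (1 / amplitude V ^ 2) •
    (!![l.activePower (amplitude V), l.reactivePower (amplitude V);
        -l.reactivePower (amplitude V), l.activePower (amplitude V)] *ᵥ V)

/-- A load node with node capacitance `C`, with state `x = C V` and the injected current as input: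
`C V' = ω₀ C (V_q, -V_d) - I_L(V) + u`, output `V`. -/
def Load.phs (l : Load) (ω₀ C : ℝ) : PHS 2 2 where
  J := fun _ => rotMatrix (ω₀ * C)
  skew := fun _ => rotMatrix_skew _
  R := fun x => l.current (C⁻¹ • x)
  G := 1
  H := fun x => 1 / 2 * (x ⬝ᵥ (C⁻¹ • x))

/-- The error system of a load node about the voltage `Vs`, with state `e = C (V - Vs)`, input
`u - us` and output `V - Vs`. -/
def Load.errorPhs (l : Load) (ω₀ C : ℝ) (Vs : DQ) : PHS 2 2 where
  J := fun _ => rotMatrix (ω₀ * C)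
  skew := fun _ => rotMatrix_skew _
  R := fun e => l.current (Vs + C⁻¹ • e) - l.current Vs
  G := 1
  H := fun e => 1 / 2 * (e ⬝ᵥ (C⁻¹ • e))

/-- The error system of a load node is strictly passive, with its Hamiltonian as storage function,
for the node voltages in the region `U`. -/
def Load.StrictlyPassive (l : Load) (ω₀ C : ℝ) (Vs : DQ) (U : Set DQ) : Prop :=
  StrictlyPassiveOn (l.errorPhs ω₀ C Vs).f (l.errorPhs ω₀ C Vs).y (l.errorPhs ω₀ C Vs).H
    {e | Vs + C⁻¹ • e ∈ U} 0 0

/-! Distributed generation units -/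

/-- The matrix through which the exchange current enters the voltage part of the DGU state. -/
def dguPort : Matrix (Fin 4) (Fin 2) ℝ := !![0, 0; 0, 0; 1, 0; 0, 1]

/-- A controlled DGU with filter inductance `Lt` and terminal capacitance `Ct` (which comprises the
shunt capacitances of the attached line ends). Its state is
`x = (Lt I_d, Lt I_q, Ct V_d, Ct V_q)`. The closed loop is a port-Hamiltonian system in the
error `x - x*`, where `x*` belongs to the filter current `Iref` and terminal voltage `Vref`, and
its input is the deviation of the exchange current from the steady value `dref`. The resistive
structure `R` comprises the damping and an optional local load at the DGU. The closed loop is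
described by these data on `region`, a set of error states. -/
structure DGU where
  Lt : ℝ
  Ct : ℝ
  Lt_pos : 0 < Lt
  Ct_pos : 0 < Ct
  Iref : DQ
  Vref : DQ
  dref : DQ
  J : (Fin 4 → ℝ) → Matrix (Fin 4) (Fin 4) ℝ
  skew : ∀ e, (J e)ᵀ = -(J e)
  R : (Fin 4 → ℝ) → (Fin 4 → ℝ)
  H : (Fin 4 → ℝ) → ℝ
  region : Set (Fin 4 → ℝ)
  J_smooth : ∀ i j, ContDiffOn ℝ 1 (fun e => J e i j) region
  R_smooth : ContDiffOn ℝ 1 R region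
  H_smooth : ContDiffOn ℝ 2 H region

/-- The closed-loop error system of a DGU. -/
def DGU.errorPhs (g : DGU) : PHS 4 2 where
  J := g.J
  skew := g.skew
  R := g.R
  G := dguPort
  H := g.H

/-- The DGU equilibrium `x* = (Lt I_d*, Lt I_q*, Ct V_d*, Ct V_q*)`. -/
def DGU.xref (g : DGU) : Fin 4 → ℝ :=
  ![g.Lt * g.Iref 0, g.Lt * g.Iref 1, g.Ct * g.Vref 0, g.Ct * g.Vref 1]

/-- The terminal voltage as a function of the state. -/
def DGU.voltage (g : DGU) (x : Fin 4 → ℝ) : DQ := ![x 2 / g.Ct, x 3 / g.Ct]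

/-- The closed-loop state equation in the state `x`, with the exchange current `d` as input. -/
def DGU.f (g : DGU) (x : Fin 4 → ℝ) (d : DQ) : Fin 4 → ℝ :=
  g.errorPhs.f (x - g.xref) (d - g.dref)

/-- The closed-loop error system is strictly passive on its region, with the closed-loop
Hamiltonian, normalized to vanish at zero error, as storage function and with supply rate
`(V - Vref)ᵀ (d - dref)`. -/
def DGU.StrictlyPassive (g : DGU) : Prop :=
  StrictlyPassiveOn g.errorPhs.f g.voltage (fun e => g.H e - g.H 0) g.region 0 0

/-! The microgrid -/

/-- An AC microgrid with DGU nodes `D`, load nodes `B` and lines `E` in an arbitrary topology: the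
bipartite graph between the nodes `D ⊕ B` and the lines `E` in which each line `e` is adjacent to
its two end nodes `src e` and `tgt e` (the current of the line is counted from `src e` to `tgt e`).
Every load node is adjacent to some line. -/
structure Microgrid (D B E : Type*) where
  ω₀ : ℝ
  ω₀_pos : 0 < ω₀
  src : E → D ⊕ B
  tgt : E → D ⊕ B
  line : E → PiLine
  dgu : D → DGU
  load : B → Load
  load_adjacent : ∀ b, ∃ e, src e = Sum.inr b ∨ tgt e = Sum.inr b

/-- States of a microgrid: the states of all lines, all DGUs and all load nodes. -/
abbrev State (D B E : Type*) : Type _ := (E → DQ) × (D → Fin 4 → ℝ) × (B → DQ)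

/-- A candidate operating point: the line currents and the load node voltages. (The references of
the DGUs are part of their data.) -/
structure OperatingPoint (B E : Type*) where
  I : E → DQ
  V : B → DQ

namespace Microgrid

variable {D B E : Type*} [Fintype D] [Fintype B] [Fintype E] [DecidableEq D] [DecidableEq B]

/-- The capacitance at a load node: the sum of the parallel shunt capacitances of the line ends
at that node. -/
def loadCap (M : Microgrid D B E) (b : B) : ℝ :=
  ∑ e, ((if M.src e = Sum.inr b then (M.line e).C else 0) +
    (if M.tgt e = Sum.inr b then (M.line e).C else 0))

/-- The exchange current into node `n` for given line currents: the negative sum of the outgoing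
line currents. -/
def exchange (M : Microgrid D B E) (I : E → DQ) (n : D ⊕ B) : DQ :=
  -∑ e, ((if M.src e = n then I e else 0) - (if M.tgt e = n then I e else 0))

/-- The current of a line in a given state. -/
def lineCurrent (M : Microgrid D B E) (x : State D B E) (e : E) : DQ :=
  (M.line e).L⁻¹ • x.1 e

/-- The voltage of a node in a given state. -/
def nodeVoltage (M : Microgrid D B E) (x : State D B E) : D ⊕ B → DQ
  | Sum.inl d => (M.dgu d).voltage (x.2.1 d)
  | Sum.inr b => (M.loadCap b)⁻¹ • x.2.2 b

/-- The interconnected microgrid. Each line is driven by the difference of its end node voltages;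
each node receives the exchange current of its lines and an external current injection `w`. The
isolated microgrid is the case `w = 0`. -/
def f (M : Microgrid D B E) (x : State D B E) (w : (D ⊕ B) × Fin 2 → ℝ) : State D B E :=
  (fun e => ((M.line e).phs M.ω₀).f (x.1 e)
      (M.nodeVoltage x (M.src e) - M.nodeVoltage x (M.tgt e)),
   fun d => (M.dgu d).f (x.2.1 d)
      (M.exchange (M.lineCurrent x) (Sum.inl d) + fun k => w (Sum.inl d, k)),
   fun b => ((M.load b).phs M.ω₀ (M.loadCap b)).f (x.2.2 b)
      (M.exchange (M.lineCurrent x) (Sum.inr b) + fun k => w (Sum.inr b, k)))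

/-- The outputs conjugated to the external current injections: the node voltages. -/
def output (M : Microgrid D B E) (x : State D B E) : (D ⊕ B) × Fin 2 → ℝ :=
  fun p => M.nodeVoltage x p.1 p.2

/-- The steady-state node voltages at an operating point. -/
def steadyVoltage (M : Microgrid D B E) (p : OperatingPoint B E) : D ⊕ B → DQ
  | Sum.inl d => (M.dgu d).Vref
  | Sum.inr b => p.V b

/-- The combined state of the line, DGU and load states `L I*`, `x*` and `C V*`. -/
def equilibrium (M : Microgrid D B E) (p : OperatingPoint B E) : State D B E :=
  (fun e => (M.line e).L • p.I e, fun d => (M.dgu d).xref, fun b => M.loadCap b • p.V b)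

/-- Each line, DGU and load node is, on its own, in equilibrium under the steady port variables
that its neighbours impose on it. -/
structure IsSteady (M : Microgrid D B E) (p : OperatingPoint B E) : Prop where
  line : ∀ e, ((M.line e).phs M.ω₀).f ((M.line e).L • p.I e)
    (M.steadyVoltage p (M.src e) - M.steadyVoltage p (M.tgt e)) = 0
  dgu_exchange : ∀ d, (M.dgu d).dref = M.exchange p.I (Sum.inl d)
  dgu : ∀ d, (M.dgu d).f (M.dgu d).xref (M.dgu d).dref = 0
  load : ∀ b, ((M.load b).phs M.ω₀ (M.loadCap b)).f (M.loadCap b • p.V b)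
    (M.exchange p.I (Sum.inr b)) = 0

/-- The total storage function: the sum of the Hamiltonians of the error systems of all lines,
DGUs and load nodes. -/
def storage (M : Microgrid D B E) (p : OperatingPoint B E) (x : State D B E) : ℝ :=
  ∑ e, ((M.line e).phs M.ω₀).H (x.1 e - (M.line e).L • p.I e) +
  ∑ d, ((M.dgu d).H (x.2.1 d - (M.dgu d).xref) - (M.dgu d).H 0) +
  ∑ b, ((M.load b).errorPhs M.ω₀ (M.loadCap b) (p.V b)).H (x.2.2 b - M.loadCap b • p.V b)

/-- The states whose DGU errors lie in the DGU regions and whose load voltages lie in the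
regions `U b`. -/
def region (M : Microgrid D B E) (U : B → Set DQ) : Set (State D B E) :=
  {x | (∀ d, x.2.1 d - (M.dgu d).xref ∈ (M.dgu d).region) ∧
    ∀ b, M.nodeVoltage x (Sum.inr b) ∈ U b}

end Microgrid

end ACMicrogrid

end

/-! Passivity survives a power-preserving interconnection. In error coordinates every component is
strictly passive: DGUs and loads by hypothesis, a line because its error dynamics dissipate `R ‖I -
I*‖²` (`PiLine.strictlyPassiveOn`). Adding the component inequalities bounds the rate of the total
storage by the sum of all supply rates. In that sum, the power that a line absorbs from its two ends
is the power that these nodes give away, so all internal terms cancel (`sum_dotProduct_exchange`)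
and only `(V - V*)ᵀ w` remains.

Strictness needs care, since some components may rest at equilibrium while others do not. There the
storage of the component is minimal, its derivative vanishes and the inequality holds with equality
(`dissipation_le`). A state other than the equilibrium has at least one displaced component, which
makes the sum strict (`sum_components_lt`).

For `w = 0` the total storage is thus a strict Lyapunov function, and the direct method applies. A
sublevel set inside a small ball is forward invariant, which gives stability; compactness away from
the equilibrium forces a uniform decay rate, which gives attraction. Existence for all times comes
from gluing local solutions of a common length on the invariant set. The vector field is `C¹` there
because the load voltages avoid zero, the only singularity of the load current. -/

namespace ACMicrogrid

/-! Strict Lyapunov functions and asymptotic stability -/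

section Lyapunov

variable {X : Type*} [NormedAddCommGroup X] [NormedSpace ℝ X]

/-- `V` is a `C¹` strict Lyapunov function on `U` for the equilibrium `xs` of `x' = g x`. -/
structure IsStrictLyapunovOn (g : X → X) (V : X → ℝ) (U : Set X) (xs : X) : Prop where
  isOpen : IsOpen U
  mem : xs ∈ U
  contDiffOn : ContDiffOn ℝ 1 V U
  equilibrium : g xs = 0
  eq_zero : V xs = 0
  pos : ∀ x ∈ U, x ≠ xs → 0 < V x
  decrease : ∀ x ∈ U, x ≠ xs → fderiv ℝ V x (g x) < 0

variable {g : X → X} {V : X → ℝ} {U : Set X} {xs : X}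

theorem IsSolutionOn.continuousOn {γ : ℝ → X} {s : Set ℝ} (hγ : IsSolutionOn g γ s) :
    ContinuousOn γ s := fun t ht => (hγ t ht).continuousWithinAt

theorem IsSolutionOn.mono {γ : ℝ → X} {s t : Set ℝ} (hγ : IsSolutionOn g γ s) (hts : t ⊆ s) :
    IsSolutionOn g γ t := fun r hr => (hγ r (hts hr)).mono hts

theorem IsSolutionOn.shift {γ : ℝ → X} (hγ : IsSolutionOn g γ (Set.Ici 0)) {a : ℝ} (ha : 0 ≤ a) :
    IsSolutionOn g (fun t => γ (t + a)) (Set.Ici 0) := by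
  intro t ht
  have ht' : 0 ≤ t := ht
  have h1 := hγ (t + a) (by simp only [Set.mem_Ici]; linarith)
  have h2 : HasDerivWithinAt (fun t : ℝ => t + a) 1 (Set.Ici 0) t :=
    (hasDerivWithinAt_id t _).add_const a
  have h3 := HasDerivWithinAt.scomp t h1 h2 (fun s hs => by
    have : 0 ≤ s := hs
    simp only [Set.mem_Ici]; linarith)
  simpa [Function.comp_def] using h3

namespace IsStrictLyapunovOn

theorem decrease_le (h : IsStrictLyapunovOn g V U xs) {x : X} (hx : x ∈ U) :
    fderiv ℝ V x (g x) ≤ 0 := by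
  by_cases hxs : x = xs
  · simp [hxs, h.equilibrium]
  · exact (h.decrease x hx hxs).le

theorem nonneg (h : IsStrictLyapunovOn g V U xs) {x : X} (hx : x ∈ U) : 0 ≤ V x := by
  by_cases hxs : x = xs
  · simp [hxs, h.eq_zero]
  · exact (h.pos x hx hxs).le

theorem differentiableAt (h : IsStrictLyapunovOn g V U xs) {x : X} (hx : x ∈ U) :
    DifferentiableAt ℝ V x :=
  (h.contDiffOn.contDiffAt (h.isOpen.mem_nhds hx)).differentiableAt one_ne_zero

/-- If the Lyapunov function decays at least at rate `m` along a solution, then it decays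
linearly. -/
theorem le_sub_mul (h : IsStrictLyapunovOn g V U xs) {γ : ℝ → X} {t m : ℝ} (ht : 0 ≤ t)
    (hγ : IsSolutionOn g γ (Set.Icc 0 t)) (hU : ∀ s ∈ Set.Icc 0 t, γ s ∈ U)
    (hm : ∀ s ∈ Set.Icc 0 t, fderiv ℝ V (γ s) (g (γ s)) ≤ -m) :
    V (γ t) ≤ V (γ 0) - m * t := by
  have hd : ∀ s ∈ Set.Icc 0 t, HasDerivWithinAt (fun s => V (γ s) + m * s)
      (fderiv ℝ V (γ s) (g (γ s)) + m) (Set.Icc 0 t) s := by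
    intro s hs
    have h1 := (h.differentiableAt (hU s hs)).hasFDerivAt.comp_hasDerivWithinAt s (hγ s hs)
    have h2 : HasDerivWithinAt (fun s : ℝ => m * s) m (Set.Icc 0 t) s := by
      simpa using (hasDerivWithinAt_id s (Set.Icc 0 t)).const_mul m
    exact h1.add h2
  have hanti : AntitoneOn (fun s => V (γ s) + m * s) (Set.Icc 0 t) :=
    antitoneOn_of_hasDerivWithinAt_nonpos (convex_Icc 0 t)
      (fun s hs => (hd s hs).continuousWithinAt)
      (fun s hs => (hd s (interior_subset hs)).mono interior_subset)
      (fun s hs => by linarith [hm s (interior_subset hs)])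
  have := hanti (Set.left_mem_Icc.2 ht) (Set.right_mem_Icc.2 ht) ht
  simp only [mul_zero, add_zero] at this
  linarith

theorem antitone (h : IsStrictLyapunovOn g V U xs) {γ : ℝ → X} {t : ℝ} (ht : 0 ≤ t)
    (hγ : IsSolutionOn g γ (Set.Icc 0 t)) (hU : ∀ s ∈ Set.Icc 0 t, γ s ∈ U) :
    V (γ t) ≤ V (γ 0) := by
  simpa using h.le_sub_mul (m := 0) ht hγ hU (fun s hs => by simpa using h.decrease_le (hU s hs))

/-- A sublevel set inside a ball, below the values on the bounding sphere, is forward invariant. -/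
theorem mem_of_isSolutionOn (h : IsStrictLyapunovOn g V U xs) {ρ c : ℝ}
    (hρ : Metric.closedBall xs ρ ⊆ U) (hc : ∀ x ∈ Metric.sphere xs ρ, c ≤ V x)
    {γ : ℝ → X} {T : ℝ} (hγ : IsSolutionOn g γ (Set.Ico 0 T))
    (h0 : γ 0 ∈ Metric.ball xs ρ) (h0c : V (γ 0) < c) {t : ℝ} (ht : t ∈ Set.Ico 0 T) :
    γ t ∈ Metric.ball xs ρ ∧ V (γ t) < c := by
  have hcont : ContinuousOn (fun s => dist (γ s) xs) (Set.Ico 0 T) :=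
    continuous_dist.comp_continuousOn (hγ.continuousOn.prodMk continuousOn_const)
  -- First exit time: if the ball is ever left, the times at distance at least `ρ` form a compact
  -- set up to `t₁`. At its least element the solution is exactly on the sphere, so `V ≥ c`,
  -- although `V` has not increased from a value below `c`.
  have hball : ∀ s ∈ Set.Ico 0 T, dist (γ s) xs < ρ := by
    by_contra! hne
    obtain ⟨t₁, ht₁, hd₁⟩ := hne
    have hIcc : ∀ {a}, a ∈ Set.Ico 0 T → Set.Icc 0 a ⊆ Set.Ico 0 T := fun {a} ha s hs =>
      ⟨hs.1, hs.2.trans_lt ha.2⟩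
    have hc₁ := hcont.mono (hIcc ht₁)
    have hK : IsCompact (Set.Icc 0 t₁ ∩ (fun s => dist (γ s) xs) ⁻¹' Set.Ici ρ) :=
      isCompact_Icc.of_isClosed_subset
        (hc₁.preimage_isClosed_of_isClosed isClosed_Icc isClosed_Ici) Set.inter_subset_left
    obtain ⟨s, ⟨hs, hsρ⟩, hmin⟩ := hK.exists_isLeast ⟨t₁, ⟨ht₁.1, le_rfl⟩, hd₁⟩
    have hsρ : ρ ≤ dist (γ s) xs := hsρ
    have hsT : s ∈ Set.Ico 0 T := hIcc ht₁ hs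
    have hlt : ∀ r ∈ Set.Ico 0 s, dist (γ r) xs < ρ := by
      intro r hr
      by_contra! hr'
      exact absurd (hmin ⟨⟨hr.1, hr.2.le.trans hs.2⟩, hr'⟩) (not_le.2 hr.2)
    have hs0 : 0 < s := by
      rcases hs.1.eq_or_lt with h' | h'
      · rw [← h'] at hsρ
        exact absurd h0 (not_lt.2 hsρ)
      · exact h'
    have hle : dist (γ s) xs ≤ ρ := by
      have hcs : ContinuousWithinAt (fun s => dist (γ s) xs) (Set.Ico 0 s) s :=
        (hcont s hsT).mono (fun r hr => ⟨hr.1, hr.2.trans hsT.2⟩)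
      have : s ∈ closure (Set.Ico 0 s) := by
        rw [closure_Ico hs0.ne]; exact ⟨hs0.le, le_rfl⟩
      have hmem := hcs.mem_closure this (t := Set.Iic ρ) (fun r hr => (hlt r hr).le)
      rwa [isClosed_Iic.closure_eq] at hmem
    have hsU : ∀ r ∈ Set.Icc 0 s, γ r ∈ U := by
      intro r hr
      apply hρ
      rcases hr.2.eq_or_lt with rfl | hr'
      · exact hle
      · exact (hlt r ⟨hr.1, hr'⟩).le
    have h1 := h.antitone hs.1 (hγ.mono (hIcc hsT)) hsU
    have h2 := hc (γ s) (le_antisymm hle hsρ)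
    linarith
  have hsub : Set.Icc 0 t ⊆ Set.Ico 0 T := fun s hs => ⟨hs.1, hs.2.trans_lt ht.2⟩
  exact ⟨hball t ht, (h.antitone ht.1 (hγ.mono hsub)
    (fun s hs => hρ (Metric.ball_subset_closedBall (hball s (hsub hs))))).trans_lt h0c⟩

variable [FiniteDimensional ℝ X]

/-- There are arbitrarily small balls on whose bounding sphere the Lyapunov function is bounded
below by a positive constant. -/
theorem exists_sphere_bound (h : IsStrictLyapunovOn g V U xs) {ε : ℝ} (hε : 0 < ε) :
    ∃ ρ > 0, ρ ≤ ε ∧ Metric.closedBall xs ρ ⊆ U ∧ ∃ c > 0, (∀ x ∈ Metric.sphere xs ρ, c ≤ V x) ∧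
      ∃ δ > 0, δ ≤ ρ ∧ ∀ x ∈ Metric.ball xs δ, V x < c := by
  have : ProperSpace X := FiniteDimensional.proper ℝ X
  obtain ⟨ρ₀, hρ₀, hsub⟩ := Metric.nhds_basis_closedBall.mem_iff.1 (h.isOpen.mem_nhds h.mem)
  set ρ := min ρ₀ ε
  have hρpos : 0 < ρ := lt_min hρ₀ hε
  have hρ : Metric.closedBall xs ρ ⊆ U :=
    (Metric.closedBall_subset_closedBall (min_le_left _ _)).trans hsub
  obtain ⟨c, hc, hcs⟩ : ∃ c > 0, ∀ x ∈ Metric.sphere xs ρ, c ≤ V x := by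
    -- The sphere is empty when the space is trivial; any positive constant then serves.
    rcases (Metric.sphere xs ρ).eq_empty_or_nonempty with he | hne
    · exact ⟨1, one_pos, by simp [he]⟩
    · have hsU : Metric.sphere xs ρ ⊆ U := Metric.sphere_subset_closedBall.trans hρ
      obtain ⟨z, hz, hmin⟩ := (isCompact_sphere xs ρ).exists_isMinOn hne
        (h.contDiffOn.continuousOn.mono hsU)
      refine ⟨V z, h.pos z (hsU hz) ?_, fun x hx => hmin hx⟩
      rintro rfl
      simp at hz
      exact hρpos.ne hz
  have hcont : ContinuousAt V xs := h.contDiffOn.continuousOn.continuousAt (h.isOpen.mem_nhds h.mem)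
  have hev : ∀ᶠ x in 𝓝 xs, V x < c := hcont.eventually_lt_const (by rwa [h.eq_zero])
  obtain ⟨δ, hδ, hδc⟩ := Metric.eventually_nhds_iff_ball.1 hev
  exact ⟨ρ, hρpos, min_le_right _ _, hρ, c, hc, hcs, min δ ρ, lt_min hδ hρpos, min_le_right _ _,
    fun x hx => hδc x (Metric.ball_subset_ball (min_le_left _ _) hx)⟩

theorem stable (h : IsStrictLyapunovOn g V U xs) :
    ∀ ε > 0, ∃ δ > 0, ∀ (γ : ℝ → X) (T : ℝ), γ 0 ∈ Metric.ball xs δ →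
      IsSolutionOn g γ (Set.Ico 0 T) → ∀ t ∈ Set.Ico 0 T, γ t ∈ Metric.ball xs ε := by
  intro ε hε
  obtain ⟨ρ, -, hρε, hρU, c, -, hcs, δ, hδ, hδρ, hδc⟩ := h.exists_sphere_bound hε
  exact ⟨δ, hδ, fun γ T h0 hγ t ht => Metric.ball_subset_ball hρε
    (h.mem_of_isSolutionOn hρU hcs hγ (Metric.ball_subset_ball hδρ h0) (hδc _ h0) ht).1⟩

/-- By stability it suffices to enter each small ball once. A solution that never did would remain
in a compact set without the equilibrium, where `V` decreases at a rate bounded away from zero, and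
`V` would become negative. -/
theorem attractive (h : IsStrictLyapunovOn g V U xs) (hg : ContinuousOn g U) :
    ∃ r > 0, ∀ γ : ℝ → X, γ 0 ∈ Metric.ball xs r →
      IsSolutionOn g γ (Set.Ici 0) → Filter.Tendsto γ Filter.atTop (𝓝 xs) := by
  have : ProperSpace X := FiniteDimensional.proper ℝ X
  obtain ⟨ρ, -, -, hρU, c, -, hcs, r, hr, hrρ, hrc⟩ := h.exists_sphere_bound one_pos
  refine ⟨r, hr, fun γ h0 hγ => ?_⟩
  -- The horizon `t + 1` puts `t` inside the half-open time interval.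
  have hin : ∀ t, 0 ≤ t → γ t ∈ Metric.closedBall xs ρ := fun t ht =>
    Metric.ball_subset_closedBall (h.mem_of_isSolutionOn hρU hcs (T := t + 1)
      (hγ.mono Set.Ico_subset_Ici_self) (Metric.ball_subset_ball hrρ h0) (hrc _ h0)
      ⟨ht, by linarith⟩).1
  rw [Metric.tendsto_atTop]
  intro ε hε
  obtain ⟨δ, hδ, hstab⟩ := h.stable ε hε
  obtain ⟨a, ha, haδ⟩ : ∃ a, 0 ≤ a ∧ γ a ∈ Metric.ball xs δ := by
    by_contra! hne
    set K : Set X := Metric.closedBall xs ρ \ Metric.ball xs δ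
    have hK : IsCompact K := (isCompact_closedBall xs ρ).diff Metric.isOpen_ball
    have hKU : K ⊆ U := Set.sdiff_subset.trans hρU
    have hγK : ∀ t, 0 ≤ t → γ t ∈ K := fun t ht => ⟨hin t ht, hne t ht⟩
    have hW : ContinuousOn (fun x => fderiv ℝ V x (g x)) K :=
      ((h.contDiffOn.continuousOn_fderiv_of_isOpen h.isOpen le_rfl).clm_apply hg).mono hKU
    obtain ⟨z, hz, hmax⟩ := hK.exists_isMaxOn ⟨γ 0, hγK 0 le_rfl⟩ hW
    have hzs : z ≠ xs := by
      rintro rfl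
      exact hz.2 (Metric.mem_ball_self hδ)
    set m := -fderiv ℝ V z (g z) with hm
    have hmpos : 0 < m := neg_pos.2 (h.decrease z (hKU hz) hzs)
    have hV0 := h.nonneg (hKU (hγK 0 le_rfl))
    -- By this time linear decay at rate `m` would bring `V` down to at most `-m < 0`.
    set t := V (γ 0) / m + 1
    have ht : 0 ≤ t := by positivity
    have h1 := h.le_sub_mul ht (hγ.mono Set.Icc_subset_Ici_self) (fun s hs => hKU (hγK s hs.1))
      (m := m) (fun s hs => by rw [hm, neg_neg]; exact hmax (hγK s hs.1))
    have h2 := h.nonneg (hKU (hγK t ht))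
    have h3 : m * t = V (γ 0) + m := by simp only [t]; field_simp
    linarith
  refine ⟨a, fun t ht => ?_⟩
  have := hstab (fun s => γ (s + a)) (t - a + 1) (by simpa using haδ)
    ((hγ.shift ha).mono Set.Ico_subset_Ici_self) (t - a) ⟨by linarith, by linarith⟩
  simpa using this

end IsStrictLyapunovOn

/-- If every initial state in `A` has a solution on a time interval of fixed length `ε` that stays
in `A`, then every initial state in `A` has a solution for all nonnegative times. -/
theorem exists_isSolutionOn_Ici {A : Set X} {ε : ℝ} (hε : 0 < ε)
    (hA : ∀ x ∈ A, ∃ α : ℝ → X, α 0 = x ∧ (∀ t ∈ Set.Ioo (-ε) ε, HasDerivAt α (g (α t)) t) ∧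
      ∀ t ∈ Set.Ico 0 ε, α t ∈ A) {x₀ : X} (hx₀ : x₀ ∈ A) :
    ∃ γ : ℝ → X, γ 0 = x₀ ∧ IsSolutionOn g γ (Set.Ici 0) := by
  choose! α hα0 hα hαA using hA
  -- A step shorter than `ε` keeps both endpoints of every piece inside the open interval of
  -- existence, so the pieces are differentiable there too.
  set h := ε / 2 with hh
  have hpos : 0 < h := half_pos hε
  set x : ℕ → X := fun n => (fun y => α y h)^[n] x₀ with hx
  have hxA : ∀ n, x n ∈ A := by
    intro n
    induction n with
    | zero => exact hx₀
    | succ n ih =>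
      simp only [hx, Function.iterate_succ_apply'] at ih ⊢
      exact hαA _ ih h ⟨hpos.le, by linarith⟩
  have hxs : ∀ n, x (n + 1) = α (x n) h := fun n => by
    simp only [hx, Function.iterate_succ_apply']
  set γ : ℝ → X := fun t => α (x ⌊t / h⌋₊) (t - ⌊t / h⌋₊ * h) with hγ
  have hγn : ∀ (n : ℕ) (t : ℝ), t ∈ Set.Ico (n * h) ((n + 1) * h) → γ t = α (x n) (t - n * h) := by
    intro n t ht
    have hn : ⌊t / h⌋₊ = n := by
      rw [Nat.floor_eq_iff (div_nonneg (le_trans (by positivity) ht.1) hpos.le)]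
      exact ⟨(le_div_iff₀ hpos).2 ht.1, (div_lt_iff₀ hpos).2 ht.2⟩
    simp only [hγ, hn]
  -- Each piece starts where the previous one ends, so the formula extends to the right endpoint.
  have hγn' : ∀ (n : ℕ) (t : ℝ), t ∈ Set.Icc (n * h) ((n + 1) * h) → γ t = α (x n) (t - n * h) := by
    intro n t ht
    rcases ht.2.eq_or_lt with rfl | hlt
    · have := hγn (n + 1) ((n + 1) * h) ⟨by push_cast; exact le_rfl, by push_cast; linarith⟩
      rw [this, hxs]
      push_cast
      rw [sub_self, hα0 _ (hxs n ▸ hxA (n + 1))]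
      congr 1
      ring
    · exact hγn n t ⟨ht.1, hlt⟩
  have hder : ∀ (n : ℕ) (t : ℝ), t ∈ Set.Icc (n * h) ((n + 1) * h) →
      HasDerivWithinAt γ (g (γ t)) (Set.Icc (n * h) ((n + 1) * h)) t := by
    intro n t ht
    have h1 : HasDerivAt (fun s => α (x n) (s - n * h)) (g (α (x n) (t - n * h))) t :=
      HasDerivAt.comp_sub_const t (n * h) (hα (x n) (hxA n) (t - n * h)
        ⟨by linarith [ht.1], by linarith [ht.2]⟩)
    rw [hγn' n t ht]
    exact h1.hasDerivWithinAt.congr (fun s hs => hγn' n s hs) (hγn' n t ht)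
  refine ⟨γ, ?_, fun t ht => ?_⟩
  · have := hγn 0 0 (by simpa using hpos)
    simpa [hα0 _ hx₀, hx] using this
  · have ht : 0 ≤ t := ht
    set n := ⌊t / h⌋₊ with hn
    have hn1 : n * h ≤ t := (le_div_iff₀ hpos).1 (Nat.floor_le (div_nonneg ht hpos.le))
    have hn2 : t < (n + 1) * h := (div_lt_iff₀ hpos).1 (Nat.lt_floor_add_one _)
    rcases hn1.eq_or_lt with heq | hlt
    · have hr := hder n t ⟨hn1, hn2.le⟩
      -- At time zero only the derivative from the right is needed; at a later grid point the
      -- derivatives of the two adjacent pieces are glued.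
      rcases Nat.eq_zero_or_pos n with h0 | h0
      · have ht0 : t = 0 := by rw [← heq, h0]; simp
        rw [h0] at hr hn2
        refine hr.mono_of_mem_nhdsWithin ?_
        rw [ht0]
        simpa using Icc_mem_nhdsGE (α := ℝ) (by simpa using hpos : (0 : ℝ) < h)
      · obtain ⟨k, hk⟩ := Nat.exists_eq_succ_of_ne_zero h0.ne'
        have hkt : ((k : ℝ) + 1) * h = t := by rw [← heq, hk]; push_cast; ring
        have hl := hder k t ⟨by linarith, hkt.ge⟩
        have hu := hl.union hr
        refine (hu.hasDerivAt ?_).hasDerivWithinAt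
        rw [hkt, heq, Set.Icc_union_Icc_eq_Icc (by linarith) hn2.le]
        exact Icc_mem_nhds (by linarith) hn2
    · exact ((hder n t ⟨hn1, hn2.le⟩).hasDerivAt (Icc_mem_nhds hlt hn2)).hasDerivWithinAt

/-- Lyapunov's direct method. -/
theorem IsStrictLyapunovOn.isAsymptoticallyStable [FiniteDimensional ℝ X]
    (h : IsStrictLyapunovOn g V U xs) (hg : ContDiffOn ℝ 1 g U) : IsAsymptoticallyStable g xs where
  equilibrium := h.equilibrium
  exists_solution := by
    have : CompleteSpace X := FiniteDimensional.complete ℝ X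
    -- Picard–Lindelöf gives one existence time `ε` for all initial states near the equilibrium. The
    -- invariant sublevel set is chosen inside that ball, so a solution can be restarted
    -- indefinitely.
    obtain ⟨r, hr, ε, hε, hsol⟩ := ContDiffAt.exists_forall_mem_closedBall_exists_eq_forall_mem_Ioo_hasDerivAt
      (hg.contDiffAt (h.isOpen.mem_nhds h.mem)) 0
    obtain ⟨ρ, -, hρr, hρU, c, -, hcs, δ, hδ, hδρ, hδc⟩ := h.exists_sphere_bound hr
    refine ⟨δ, hδ, fun x₀ hx₀ => exists_isSolutionOn_Ici (A := {x | x ∈ Metric.ball xs ρ ∧ V x < c})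
      hε (fun x hx => ?_) ⟨Metric.ball_subset_ball hδρ hx₀, hδc _ hx₀⟩⟩
    obtain ⟨α, hα0, hα⟩ := hsol x (Metric.ball_subset_closedBall (Metric.ball_subset_ball hρr hx.1))
    rw [zero_sub, zero_add] at hα
    refine ⟨α, hα0, hα, fun t ht => h.mem_of_isSolutionOn hρU hcs
      (fun s hs => (hα s ⟨by linarith [hs.1], hs.2⟩).hasDerivWithinAt) ?_ ?_ ht⟩
    · rw [hα0]; exact hx.1
    · rw [hα0]; exact hx.2
  stable := h.stable
  attractive := h.attractive hg.continuousOn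

end Lyapunov

/-! Strict passivity of the components -/

namespace StrictlyPassiveOn

variable {X : Type*} [NormedAddCommGroup X] [NormedSpace ℝ X] {ι : Type*} [Fintype ι]
  {f : X → (ι → ℝ) → X} {h : X → ι → ℝ} {S : X → ℝ} {U : Set X} {xs : X} {us : ι → ℝ}

theorem differentiableAt (hS : StrictlyPassiveOn f h S U xs us) {x : X} (hx : x ∈ U) :
    DifferentiableAt ℝ S x :=
  (hS.contDiffOn.contDiffAt (hS.isOpen.mem_nhds hx)).differentiableAt one_ne_zero

theorem storage_nonneg (hS : StrictlyPassiveOn f h S U xs us) {x : X} (hx : x ∈ U) : 0 ≤ S x := by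
  by_cases hxs : x = xs
  · simp [hxs, hS.storage_eq]
  · exact (hS.storage_pos x hx hxs).le

/-- The storage function has a local minimum at the equilibrium. -/
theorem fderiv_eq_zero (hS : StrictlyPassiveOn f h S U xs us) : fderiv ℝ S xs = 0 := by
  refine IsLocalMin.fderiv_eq_zero ?_
  filter_upwards [hS.isOpen.mem_nhds hS.mem] with x hx
  rw [hS.storage_eq]
  exact hS.storage_nonneg hx

/-- At the equilibrium both sides vanish, for every input. This covers the components that sit at
rest while the rest of the grid does not. -/
theorem dissipation_le (hS : StrictlyPassiveOn f h S U xs us) {x : X} (hx : x ∈ U) (u : ι → ℝ) :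
    fderiv ℝ S x (f x u) ≤ (h x - h xs) ⬝ᵥ (u - us) := by
  by_cases hxs : x = xs
  · simp [hxs, hS.fderiv_eq_zero]
  · exact (hS.dissipation x hx hxs u).le

/-- Strict passivity of an error system at the origin, in terms of the original coordinates. -/
theorem of_error {f : X → (ι → ℝ) → X} {h : X → ι → ℝ} {S : X → ℝ} {U : Set X}
    (hS : StrictlyPassiveOn f h S U 0 0) {f' : X → (ι → ℝ) → X} {h' : X → ι → ℝ} {xs : X}
    {us : ι → ℝ} (hf : ∀ x u, f' x u = f (x - xs) (u - us))
    (hh : ∀ x, h' x - h' xs = h (x - xs) - h 0) :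
    StrictlyPassiveOn f' h' (fun x => S (x - xs)) {x | x - xs ∈ U} xs us where
  isOpen := hS.isOpen.preimage (continuous_id.sub continuous_const)
  mem := by simpa using hS.mem
  contDiffOn := hS.contDiffOn.comp (contDiff_id.sub contDiff_const).contDiffOn fun _ hx => hx
  storage_eq := by simpa using hS.storage_eq
  storage_pos x hx hne := hS.storage_pos _ hx (sub_ne_zero.2 hne)
  dissipation x hx hne u := by
    rw [fderiv_comp_sub, hf, hh]
    simpa using hS.dissipation _ hx (sub_ne_zero.2 hne) (u - us)

end StrictlyPassiveOn

/-- The energy `a ‖x‖² / 2`. -/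
theorem hasFDerivAt_energy (a : ℝ) (x : DQ) :
    HasFDerivAt (fun x : DQ => 1 / 2 * (x ⬝ᵥ (a • x)))
      (a • (x 0 • ContinuousLinearMap.proj (R := ℝ) (φ := fun _ : Fin 2 => ℝ) 0 +
        x 1 • ContinuousLinearMap.proj (R := ℝ) (φ := fun _ : Fin 2 => ℝ) 1)) x := by
  have h0 := (hasFDerivAt_apply (𝕜 := ℝ) (F' := fun _ : Fin 2 => ℝ) 0 x).pow 2
  have h1 := (hasFDerivAt_apply (𝕜 := ℝ) (F' := fun _ : Fin 2 => ℝ) 1 x).pow 2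
  have h2 := (h0.add h1).const_mul (a / 2)
  refine (h2.congr_fderiv ?_).congr_of_eventuallyEq (Filter.Eventually.of_forall fun y => ?_)
  · ext v
    simp
    ring
  · simp [dotProduct, Fin.sum_univ_two]
    ring

theorem fderiv_energy (a : ℝ) (x v : DQ) :
    fderiv ℝ (fun x : DQ => 1 / 2 * (x ⬝ᵥ (a • x))) x v = (a • x) ⬝ᵥ v := by
  rw [(hasFDerivAt_energy a x).fderiv]
  simp [dotProduct, Fin.sum_univ_two]
  ring

theorem grad_energy (a : ℝ) (x : DQ) : grad (fun x : DQ => 1 / 2 * (x ⬝ᵥ (a • x))) x = a • x := by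
  ext k
  rw [grad, fderiv_energy]
  simp

theorem contDiff_energy (a : ℝ) : ContDiff ℝ 1 (fun x : DQ => 1 / 2 * (x ⬝ᵥ (a • x))) := by
  simp only [dotProduct, Fin.sum_univ_two, Pi.smul_apply, smul_eq_mul]
  fun_prop

theorem energy_pos {a : ℝ} (ha : 0 < a) {x : DQ} (hx : x ≠ 0) : 0 < 1 / 2 * (x ⬝ᵥ (a • x)) := by
  have : 0 < x ⬝ᵥ x := lt_of_le_of_ne (Finset.sum_nonneg fun i _ => mul_self_nonneg _)
    (Ne.symm (mt dotProduct_self_eq_zero.1 hx))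
  rw [dotProduct_smul, smul_eq_mul]
  positivity

theorem dotProduct_rotMatrix_mulVec (a : ℝ) (x : DQ) : x ⬝ᵥ (rotMatrix a *ᵥ x) = 0 := by
  simp [rotMatrix, dotProduct, Matrix.mulVec, Fin.sum_univ_two]
  ring

theorem PiLine.phs_f (l : PiLine) (ω₀ : ℝ) (x u : DQ) :
    (l.phs ω₀).f x u = rotMatrix (ω₀ * l.L) *ᵥ (l.L⁻¹ • x) - (l.R / l.L) • x + u := by
  simp only [PHS.f, PiLine.phs, grad_energy, Matrix.one_mulVec]

/-- The line is linear, so its error dynamics are the line equation itself. The rotation does no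
work, and the resistor dissipates `(R / L²) ‖x‖² = R ‖I‖²`. -/
theorem PiLine.strictlyPassiveOn (l : PiLine) (ω₀ : ℝ) {Is us : DQ}
    (hs : (l.phs ω₀).f (l.L • Is) us = 0) :
    StrictlyPassiveOn (l.phs ω₀).f (fun x => l.L⁻¹ • x)
      (fun x => (l.phs ω₀).H (x - l.L • Is)) Set.univ (l.L • Is) us := by
  have hL := l.L_pos
  have hR := l.R_pos
  have h0 : StrictlyPassiveOn (l.phs ω₀).f (fun x => l.L⁻¹ • x) (l.phs ω₀).H Set.univ 0 0 :=
    { isOpen := isOpen_univ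
      mem := Set.mem_univ _
      contDiffOn := (contDiff_energy _).contDiffOn
      storage_eq := by simp [PiLine.phs]
      storage_pos := fun x _ hx => energy_pos (inv_pos.2 hL) hx
      dissipation := fun x _ hx u => by
        have h1 := energy_pos (a := l.R / l.L ^ 2) (by positivity) hx
        have h2 : fderiv ℝ (l.phs ω₀).H x ((l.phs ω₀).f x u) =
            (l.L⁻¹ • x) ⬝ᵥ ((l.phs ω₀).f x u) := fderiv_energy _ _ _
        rw [h2, PiLine.phs_f, dotProduct_add, dotProduct_sub, dotProduct_rotMatrix_mulVec]
        have h3 : (l.L⁻¹ • x) ⬝ᵥ ((l.R / l.L) • x) = x ⬝ᵥ ((l.R / l.L ^ 2) • x) := by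
          simp only [smul_dotProduct, dotProduct_smul, smul_eq_mul]
          field_simp
        rw [h3]
        simp only [smul_zero, sub_zero]
        linarith }
  have := h0.of_error (f' := (l.phs ω₀).f) (h' := fun x => l.L⁻¹ • x) (xs := l.L • Is) (us := us)
    (fun x u => by
      -- Subtracting the steady-state equation turns the line equation into its error form.
      rw [← sub_zero ((l.phs ω₀).f x u), ← hs]
      simp only [PiLine.phs_f, smul_sub, Matrix.mulVec_sub]
      abel)
    (fun x => by simp [smul_sub])
  simpa using this

theorem Load.phs_f (l : Load) (ω₀ C : ℝ) (x u : DQ) :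
    (l.phs ω₀ C).f x u = rotMatrix (ω₀ * C) *ᵥ (C⁻¹ • x) - l.current (C⁻¹ • x) + u := by
  simp only [PHS.f, Load.phs, grad_energy, Matrix.one_mulVec]

theorem Load.errorPhs_f (l : Load) (ω₀ C : ℝ) (Vs e u : DQ) :
    (l.errorPhs ω₀ C Vs).f e u = rotMatrix (ω₀ * C) *ᵥ (C⁻¹ • e) -
      (l.current (Vs + C⁻¹ • e) - l.current Vs) + u := by
  simp only [PHS.f, Load.errorPhs, grad_energy, Matrix.one_mulVec]

theorem Load.errorPhs_y (l : Load) (ω₀ C : ℝ) (Vs e : DQ) :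
    (l.errorPhs ω₀ C Vs).y e = C⁻¹ • e := by
  simp only [PHS.y, Load.errorPhs, grad_energy, Matrix.transpose_one, Matrix.one_mulVec]

/-- The load current is nonlinear, but subtracting the steady-state equation leaves exactly the
current increment of the error system. -/
theorem Load.StrictlyPassive.strictlyPassiveOn {l : Load} {ω₀ C : ℝ} (hC : C ≠ 0) {Vs us : DQ}
    {U : Set DQ} (h : l.StrictlyPassive ω₀ C Vs U) (hs : (l.phs ω₀ C).f (C • Vs) us = 0) :
    StrictlyPassiveOn (l.phs ω₀ C).f (fun x => C⁻¹ • x)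
      (fun x => (l.errorPhs ω₀ C Vs).H (x - C • Vs)) {x | C⁻¹ • x ∈ U} (C • Vs) us := by
  have hV : ∀ x : DQ, Vs + C⁻¹ • (x - C • Vs) = C⁻¹ • x := fun x => by
    rw [smul_sub, inv_smul_smul₀ hC]; abel
  have := h.of_error (f' := (l.phs ω₀ C).f) (h' := fun x => C⁻¹ • x) (xs := C • Vs) (us := us)
    (fun x u => by
      rw [← sub_zero ((l.phs ω₀ C).f x u), ← hs, Load.errorPhs_f, hV]
      simp only [Load.phs_f, smul_sub, Matrix.mulVec_sub, inv_smul_smul₀ hC]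
      abel)
    (fun x => by simp [Load.errorPhs_y, smul_sub])
  simpa only [Set.mem_ofPred_eq, hV] using this

theorem DGU.StrictlyPassive.strictlyPassiveOn {g : DGU} (h : g.StrictlyPassive) :
    StrictlyPassiveOn g.f g.voltage (fun x => g.H (x - g.xref) - g.H 0)
      {x | x - g.xref ∈ g.region} g.xref g.dref :=
  h.of_error (fun _ _ => rfl) fun x => by
    ext k
    fin_cases k <;> simp [DGU.voltage, sub_div]

theorem DGU.voltage_xref (g : DGU) : g.voltage g.xref = g.Vref := by
  have := g.Ct_pos.ne'
  ext k
  fin_cases k <;> simp [DGU.voltage, DGU.xref] <;> field_simp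

/-! Smoothness of the components -/

theorem amplitude_pos {V : DQ} (hV : V ≠ 0) : 0 < V 0 ^ 2 + V 1 ^ 2 := by
  by_contra! h
  apply hV
  ext k
  fin_cases k <;> simp <;> nlinarith [sq_nonneg (V 0), sq_nonneg (V 1)]

theorem contDiffAt_amplitude {V : DQ} (hV : V ≠ 0) : ContDiffAt ℝ 1 amplitude V := by
  unfold amplitude
  exact ContDiffAt.sqrt (by fun_prop) (amplitude_pos hV).ne'

theorem Load.contDiffAt_activePower (l : Load) {v : ℝ} (hv : 0 < v) :
    ContDiffAt ℝ 1 l.activePower v := by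
  cases l with
  | zip => unfold Load.activePower; fun_prop
  | exponential P₀ Q₀ V₀ np nq hP hQ hV =>
    unfold Load.activePower
    exact contDiffAt_const.mul (ContDiffAt.rpow_const_of_ne (by fun_prop) (by positivity))

theorem Load.contDiffAt_reactivePower (l : Load) {v : ℝ} (hv : 0 < v) :
    ContDiffAt ℝ 1 l.reactivePower v := by
  cases l with
  | zip => unfold Load.reactivePower; fun_prop
  | exponential P₀ Q₀ V₀ np nq hP hQ hV =>
    unfold Load.reactivePower
    exact contDiffAt_const.mul (ContDiffAt.rpow_const_of_ne (by fun_prop) (by positivity))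

/-- Away from zero voltage the amplitude is smooth and positive, so real powers of it and division
by its square are harmless. -/
theorem Load.contDiffAt_current (l : Load) {V : DQ} (hV : V ≠ 0) : ContDiffAt ℝ 1 l.current V := by
  have hpos : 0 < amplitude V := Real.sqrt_pos.2 (amplitude_pos hV)
  have hA := contDiffAt_amplitude hV
  have hP : ContDiffAt ℝ 1 (fun V => l.activePower (amplitude V)) V :=
    ContDiffAt.comp V (l.contDiffAt_activePower hpos) hA
  have hQ : ContDiffAt ℝ 1 (fun V => l.reactivePower (amplitude V)) V :=
    ContDiffAt.comp V (l.contDiffAt_reactivePower hpos) hA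
  have hA2 : ContDiffAt ℝ 1 (fun V => 1 / amplitude V ^ 2) V :=
    contDiffAt_const.div (hA.pow 2) (by positivity)
  have h0 : ContDiffAt ℝ 1 (fun V : DQ => V 0) V := by fun_prop
  have h1 : ContDiffAt ℝ 1 (fun V : DQ => V 1) V := by fun_prop
  refine contDiffAt_pi.2 fun k => ?_
  fin_cases k
  · simp only [Load.current, Matrix.mulVec, dotProduct, Fin.sum_univ_two, Pi.smul_apply,
      smul_eq_mul]
    exact hA2.mul ((hP.mul h0).add (hQ.mul h1))
  · simp only [Load.current, Matrix.mulVec, dotProduct, Fin.sum_univ_two, Pi.smul_apply,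
      smul_eq_mul]
    exact hA2.mul ((hQ.neg.mul h0).add (hP.mul h1))

theorem contDiff_mulVec {m n : ℕ} (A : Matrix (Fin m) (Fin n) ℝ) :
    ContDiff ℝ 1 (fun v : Fin n → ℝ => A *ᵥ v) := by
  refine contDiff_pi.2 fun i => ?_
  simp only [Matrix.mulVec, dotProduct]
  fun_prop

theorem PiLine.contDiff_f (l : PiLine) (ω₀ : ℝ) :
    ContDiff ℝ 1 (fun z : DQ × DQ => (l.phs ω₀).f z.1 z.2) := by
  simp only [PiLine.phs_f]
  exact (((contDiff_mulVec _).comp (by fun_prop)).sub (by fun_prop)).add contDiff_snd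

theorem Load.contDiffAt_f (l : Load) (ω₀ C : ℝ) {z : DQ × DQ} (hz : C⁻¹ • z.1 ≠ 0) :
    ContDiffAt ℝ 1 (fun z : DQ × DQ => (l.phs ω₀ C).f z.1 z.2) z := by
  simp only [Load.phs_f]
  have h1 : ContDiffAt ℝ 1 (fun z : DQ × DQ => C⁻¹ • z.1) z := by fun_prop
  exact (((contDiff_mulVec _).contDiffAt.comp z h1).sub
    (ContDiffAt.comp z (l.contDiffAt_current hz) h1)).add contDiffAt_snd

/-- Passing to the gradient costs one derivative, so a `C²` Hamiltonian is what makes the closed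
loop `C¹`. -/
theorem contDiffOn_grad {n : ℕ} {H : (Fin n → ℝ) → ℝ} {s : Set (Fin n → ℝ)} (hs : IsOpen s)
    (hH : ContDiffOn ℝ 2 H s) : ContDiffOn ℝ 1 (grad H) s := by
  refine contDiffOn_pi.2 fun k => ?_
  exact (hH.fderiv_of_isOpen hs (m := 1) (by norm_num)).clm_apply contDiffOn_const

theorem DGU.contDiffOn_errorPhs_f (g : DGU) (hg : IsOpen g.region) :
    ContDiffOn ℝ 1 (fun z : (Fin 4 → ℝ) × DQ => g.errorPhs.f z.1 z.2) (g.region ×ˢ Set.univ) := by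
  have hfst : Set.MapsTo (Prod.fst : (Fin 4 → ℝ) × DQ → _) (g.region ×ˢ Set.univ) g.region :=
    fun z hz => hz.1
  have hgr := (contDiffOn_grad hg g.H_smooth).comp contDiffOn_fst hfst
  have hJ : ContDiffOn ℝ 1 (fun z : (Fin 4 → ℝ) × DQ => g.J z.1 *ᵥ grad g.H z.1)
      (g.region ×ˢ Set.univ) := by
    refine contDiffOn_pi.2 fun i => ?_
    simp only [Matrix.mulVec, dotProduct]
    exact ContDiffOn.sum fun j _ =>
      ((g.J_smooth i j).comp contDiffOn_fst hfst).mul (contDiffOn_pi.1 hgr j)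
  exact (hJ.sub (g.R_smooth.comp contDiffOn_fst hfst)).add
    ((contDiff_mulVec _).comp contDiff_snd).contDiffOn

/-! The interconnection -/

namespace Microgrid

variable {D B E : Type*} [Fintype E] [DecidableEq D] [DecidableEq B]

/-- Adjacency to a line supplies at least one positive shunt capacitance, so load voltages can be
recovered from load states. -/
theorem loadCap_pos (M : Microgrid D B E) (b : B) : 0 < M.loadCap b := by
  have hC := fun e => (M.line e).C_pos
  have h1 : ∀ e, 0 ≤ if M.src e = Sum.inr b then (M.line e).C else 0 := fun e => by
    split_ifs <;> simp [(hC e).le]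
  have h2 : ∀ e, 0 ≤ if M.tgt e = Sum.inr b then (M.line e).C else 0 := fun e => by
    split_ifs <;> simp [(hC e).le]
  obtain ⟨e, he⟩ := M.load_adjacent b
  refine Finset.sum_pos' (fun e _ => add_nonneg (h1 e) (h2 e)) ⟨e, Finset.mem_univ e, ?_⟩
  rcases he with he | he
  · rw [if_pos he]
    exact add_pos_of_pos_of_nonneg (hC e) (h2 e)
  · rw [if_pos he]
    exact add_pos_of_nonneg_of_pos (h1 e) (hC e)

theorem lineCurrent_equilibrium (M : Microgrid D B E) (p : OperatingPoint B E) :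
    M.lineCurrent (M.equilibrium p) = p.I := by
  funext e
  simp [lineCurrent, equilibrium, inv_smul_smul₀ (M.line e).L_pos.ne']

theorem nodeVoltage_equilibrium (M : Microgrid D B E) (p : OperatingPoint B E) :
    M.nodeVoltage (M.equilibrium p) = M.steadyVoltage p := by
  funext n
  cases n with
  | inl d => exact (M.dgu d).voltage_xref
  | inr b => exact inv_smul_smul₀ (M.loadCap_pos b).ne' _

theorem exchange_sub (M : Microgrid D B E) (I I' : E → DQ) (n : D ⊕ B) :
    M.exchange I n - M.exchange I' n = M.exchange (I - I') n := by
  simp only [exchange, neg_sub_neg, ← Finset.sum_sub_distrib, ← Finset.sum_neg_distrib,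
    Pi.sub_apply]
  refine Finset.sum_congr rfl fun e _ => ?_
  split_ifs <;> abel

theorem f_equilibrium (M : Microgrid D B E) {p : OperatingPoint B E} (hp : M.IsSteady p) :
    M.f (M.equilibrium p) 0 = 0 := by
  have hw : (fun _ : Fin 2 => (0 : ℝ)) = 0 := rfl
  refine Prod.ext (funext fun e => ?_) (Prod.ext (funext fun d => ?_) (funext fun b => ?_))
  · simp only [f, nodeVoltage_equilibrium]
    exact hp.line e
  · simp only [f, lineCurrent_equilibrium, Pi.zero_apply, hw, add_zero, ← hp.dgu_exchange]
    exact hp.dgu d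
  · simp only [f, lineCurrent_equilibrium, Pi.zero_apply, hw, add_zero]
    exact hp.load b

variable [Fintype D] [Fintype B]

/-- The interconnection of lines and nodes preserves power. -/
theorem sum_dotProduct_exchange (M : Microgrid D B E) (I : E → DQ) (V : D ⊕ B → DQ) :
    ∑ n, V n ⬝ᵥ M.exchange I n = -∑ e, I e ⬝ᵥ (V (M.src e) - V (M.tgt e)) := by
  simp only [exchange, dotProduct_neg, dotProduct_sum, Finset.sum_neg_distrib]
  -- Summed line by line, each current meets only the voltages of its two ends, with opposite signs.
  rw [Finset.sum_comm]
  congr 1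
  refine Finset.sum_congr rfl fun e _ => ?_
  simp only [dotProduct_sub, Finset.sum_sub_distrib]
  have h : ∀ m : D ⊕ B, ∑ n, V n ⬝ᵥ (if m = n then I e else 0) = I e ⬝ᵥ V m := fun m => by
    rw [Finset.sum_eq_single m]
    · rw [if_pos rfl, dotProduct_comm]
    · intro n _ hn
      rw [if_neg hn.symm, dotProduct_zero]
    · simp
  rw [h, h]

theorem contDiff_nodeVoltage (M : Microgrid D B E) (n : D ⊕ B) :
    ContDiff ℝ 1 (fun x : State D B E => M.nodeVoltage x n) := by
  refine contDiff_pi.2 fun k => ?_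
  cases n with
  | inl d =>
    fin_cases k <;> simp [nodeVoltage, DGU.voltage] <;> fun_prop
  | inr b =>
    simp only [nodeVoltage]
    fun_prop

theorem contDiff_exchange (M : Microgrid D B E) (n : D ⊕ B) :
    ContDiff ℝ 1 (fun x : State D B E => M.exchange (M.lineCurrent x) n) := by
  simp only [exchange, lineCurrent]
  refine (ContDiff.sum fun e _ => ?_).neg
  split_ifs <;> fun_prop

theorem isOpen_region (M : Microgrid D B E) {U : B → Set DQ} (hU : ∀ b, IsOpen (U b))
    (hg : ∀ d, IsOpen (M.dgu d).region) : IsOpen (M.region U) := by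
  have h : M.region U =
      (⋂ d, (fun x : State D B E => x.2.1 d - (M.dgu d).xref) ⁻¹' (M.dgu d).region) ∩
        ⋂ b, (fun x : State D B E => M.nodeVoltage x (Sum.inr b)) ⁻¹' U b := by
    ext x
    simp [region]
  rw [h]
  exact (isOpen_iInter_of_finite fun d => (hg d).preimage (by fun_prop)).inter
    (isOpen_iInter_of_finite fun b => (hU b).preimage (M.contDiff_nodeVoltage _).continuous)

/-- This is the regularity that Picard–Lindelöf needs; excluding zero load voltage keeps the load
currents smooth. -/
theorem contDiffOn_f (M : Microgrid D B E) {U : B → Set DQ} (hU0 : ∀ b, (0 : DQ) ∉ U b)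
    (hg : ∀ d, IsOpen (M.dgu d).region) :
    ContDiffOn ℝ 1 (fun x => M.f x 0) (M.region U) := by
  refine ContDiffOn.prodMk (contDiffOn_pi.2 fun e => ?_)
    (ContDiffOn.prodMk (contDiffOn_pi.2 fun d => ?_) (contDiffOn_pi.2 fun b => ?_))
  · exact (((M.line e).contDiff_f M.ω₀).comp (ContDiff.prodMk (by fun_prop)
      ((M.contDiff_nodeVoltage _).sub (M.contDiff_nodeVoltage _)))).contDiffOn
  · have hz : ContDiff ℝ 1 (fun x : State D B E => (x.2.1 d - (M.dgu d).xref,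
        M.exchange (M.lineCurrent x) (Sum.inl d) + (fun _ => 0) - (M.dgu d).dref)) :=
      ContDiff.prodMk (by fun_prop)
        (((M.contDiff_exchange _).add contDiff_const).sub contDiff_const)
    exact ((M.dgu d).contDiffOn_errorPhs_f (hg d)).comp hz.contDiffOn
      fun x hx => ⟨hx.1 d, Set.mem_univ _⟩
  · have hz : ContDiff ℝ 1 (fun x : State D B E => (x.2.2 b,
        M.exchange (M.lineCurrent x) (Sum.inr b) + (fun _ => 0))) :=
      ContDiff.prodMk (by fun_prop) ((M.contDiff_exchange _).add contDiff_const)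
    intro x hx
    have hne : (M.loadCap b)⁻¹ • x.2.2 b ≠ 0 := fun h0 => hU0 b (h0 ▸ hx.2 b)
    exact (ContDiffAt.comp x ((M.load b).contDiffAt_f M.ω₀ (M.loadCap b) hne)
      hz.contDiffAt).contDiffWithinAt

end Microgrid

/-- The derivative of a sum of functions of the component states. -/
theorem fderiv_sum_components {D B E : Type*} [Fintype D] [Fintype B] [Fintype E]
    {S₁ : E → DQ → ℝ} {S₂ : D → (Fin 4 → ℝ) → ℝ} {S₃ : B → DQ → ℝ} {x : State D B E}
    (h₁ : ∀ e, DifferentiableAt ℝ (S₁ e) (x.1 e)) (h₂ : ∀ d, DifferentiableAt ℝ (S₂ d) (x.2.1 d))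
    (h₃ : ∀ b, DifferentiableAt ℝ (S₃ b) (x.2.2 b)) (v : State D B E) :
    fderiv ℝ (fun x : State D B E =>
      ∑ e, S₁ e (x.1 e) + ∑ d, S₂ d (x.2.1 d) + ∑ b, S₃ b (x.2.2 b)) x v =
    ∑ e, fderiv ℝ (S₁ e) (x.1 e) (v.1 e) + ∑ d, fderiv ℝ (S₂ d) (x.2.1 d) (v.2.1 d) +
      ∑ b, fderiv ℝ (S₃ b) (x.2.2 b) (v.2.2 b) := by
  have k₁ : HasFDerivAt (fun x : State D B E => ∑ e, S₁ e (x.1 e)) _ x :=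
    HasFDerivAt.fun_sum fun e _ => (h₁ e).hasFDerivAt.comp x
      (((ContinuousLinearMap.proj (R := ℝ) (φ := fun _ : E => DQ) e).comp
        (ContinuousLinearMap.fst ℝ (E → DQ) ((D → Fin 4 → ℝ) × (B → DQ)))).hasFDerivAt)
  have k₂ : HasFDerivAt (fun x : State D B E => ∑ d, S₂ d (x.2.1 d)) _ x :=
    HasFDerivAt.fun_sum fun d _ => (h₂ d).hasFDerivAt.comp x
      (((ContinuousLinearMap.proj (R := ℝ) (φ := fun _ : D => Fin 4 → ℝ) d).comp
        ((ContinuousLinearMap.fst ℝ (D → Fin 4 → ℝ) (B → DQ)).comp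
          (ContinuousLinearMap.snd ℝ (E → DQ) ((D → Fin 4 → ℝ) × (B → DQ))))).hasFDerivAt)
  have k₃ : HasFDerivAt (fun x : State D B E => ∑ b, S₃ b (x.2.2 b)) _ x :=
    HasFDerivAt.fun_sum fun b _ => (h₃ b).hasFDerivAt.comp x
      (((ContinuousLinearMap.proj (R := ℝ) (φ := fun _ : B => DQ) b).comp
        ((ContinuousLinearMap.snd ℝ (D → Fin 4 → ℝ) (B → DQ)).comp
          (ContinuousLinearMap.snd ℝ (E → DQ) ((D → Fin 4 → ℝ) × (B → DQ))))).hasFDerivAt)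
  rw [((k₁.fun_add k₂).fun_add k₃).fderiv]
  simp

/-- A sum of componentwise inequalities is strict if it is strict at the components in which two
states differ. -/
theorem sum_components_lt {D B E : Type*} [Fintype D] [Fintype B] [Fintype E]
    {x y : State D B E} (hxy : x ≠ y) {a₁ c₁ : E → ℝ} {a₂ c₂ : D → ℝ} {a₃ c₃ : B → ℝ}
    (h₁ : ∀ e, a₁ e ≤ c₁ e) (h₂ : ∀ d, a₂ d ≤ c₂ d) (h₃ : ∀ b, a₃ b ≤ c₃ b)
    (l₁ : ∀ e, x.1 e ≠ y.1 e → a₁ e < c₁ e) (l₂ : ∀ d, x.2.1 d ≠ y.2.1 d → a₂ d < c₂ d)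
    (l₃ : ∀ b, x.2.2 b ≠ y.2.2 b → a₃ b < c₃ b) :
    ∑ e, a₁ e + ∑ d, a₂ d + ∑ b, a₃ b < ∑ e, c₁ e + ∑ d, c₂ d + ∑ b, c₃ b := by
  have s₁ := Finset.sum_le_sum fun e (_ : e ∈ Finset.univ) => h₁ e
  have s₂ := Finset.sum_le_sum fun d (_ : d ∈ Finset.univ) => h₂ d
  have s₃ := Finset.sum_le_sum fun b (_ : b ∈ Finset.univ) => h₃ b
  by_cases e₁ : x.1 = y.1
  · by_cases e₂ : x.2.1 = y.2.1
    · have e₃ : x.2.2 ≠ y.2.2 := fun e₃ => hxy (Prod.ext e₁ (Prod.ext e₂ e₃))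
      obtain ⟨b, hb⟩ := Function.ne_iff.1 e₃
      have := Finset.sum_lt_sum (fun b _ => h₃ b) ⟨b, Finset.mem_univ b, l₃ b hb⟩
      linarith
    · obtain ⟨d, hd⟩ := Function.ne_iff.1 e₂
      have := Finset.sum_lt_sum (fun d _ => h₂ d) ⟨d, Finset.mem_univ d, l₂ d hd⟩
      linarith
  · obtain ⟨e, he⟩ := Function.ne_iff.1 e₁
    have := Finset.sum_lt_sum (fun e _ => h₁ e) ⟨e, Finset.mem_univ e, l₁ e he⟩
    linarith

/-! ### Strict passivity of the interconnected microgrid -/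

namespace Microgrid

variable {D B E : Type*} [Fintype D] [Fintype B] [Fintype E] [DecidableEq D] [DecidableEq B]

theorem strictlyPassiveOn (M : Microgrid D B E) {p : OperatingPoint B E} (hp : M.IsSteady p)
    {U : B → Set DQ} (hU : ∀ b, IsOpen (U b))
    (hdgu : ∀ d, (M.dgu d).StrictlyPassive)
    (hload : ∀ b, (M.load b).StrictlyPassive M.ω₀ (M.loadCap b) (p.V b) (U b)) :
    StrictlyPassiveOn M.f M.output (M.storage p) (M.region U) (M.equilibrium p) 0 := by
  have h₁ := fun e => (M.line e).strictlyPassiveOn M.ω₀ (hp.line e)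
  have h₂ := fun d => (hdgu d).strictlyPassiveOn
  have h₃ := fun b => (hload b).strictlyPassiveOn (M.loadCap_pos b).ne' (hp.load b)
  have hs : ∀ x, M.storage p x = ∑ e, ((M.line e).phs M.ω₀).H (x.1 e - (M.line e).L • p.I e) +
      ∑ d, ((M.dgu d).H (x.2.1 d - (M.dgu d).xref) - (M.dgu d).H 0) +
      ∑ b, ((M.load b).errorPhs M.ω₀ (M.loadCap b) (p.V b)).H
        (x.2.2 b - M.loadCap b • p.V b) := fun x => rfl
  have hs0 : M.storage p (M.equilibrium p) = 0 := by
    have e₁ := Finset.sum_eq_zero fun e (_ : e ∈ Finset.univ) => (h₁ e).storage_eq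
    have e₂ := Finset.sum_eq_zero fun d (_ : d ∈ Finset.univ) => (h₂ d).storage_eq
    have e₃ := Finset.sum_eq_zero fun b (_ : b ∈ Finset.univ) => (h₃ b).storage_eq
    exact (congrArg₂ (· + ·) (congrArg₂ (· + ·) e₁ e₂) e₃).trans (by simp)
  refine ⟨M.isOpen_region hU fun d => (hdgu d).isOpen, ⟨fun d => (h₂ d).mem, fun b => (h₃ b).mem⟩,
    ?_, hs0, fun x hx hne => ?_, fun x hx hne w => ?_⟩
  · refine (ContDiffOn.add (ContDiffOn.sum fun e _ => ?_) (ContDiffOn.sum fun d _ => ?_)).add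
      (ContDiffOn.sum fun b _ => ?_)
    · exact (h₁ e).contDiffOn.comp (t := Set.univ)
        (ContDiff.contDiffOn (f := fun x : State D B E => x.1 e) (by fun_prop))
        fun x _ => Set.mem_univ _
    · exact (h₂ d).contDiffOn.comp
        (ContDiff.contDiffOn (f := fun x : State D B E => x.2.1 d) (by fun_prop))
        fun x hx => hx.1 d
    · exact (h₃ b).contDiffOn.comp
        (ContDiff.contDiffOn (f := fun x : State D B E => x.2.2 b) (by fun_prop))
        fun x hx => hx.2 b
  · have := sum_components_lt hne.symm (a₁ := fun _ => 0) (a₂ := fun _ => 0) (a₃ := fun _ => 0)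
      (fun e => (h₁ e).storage_nonneg (Set.mem_univ (x.1 e)))
      (fun d => (h₂ d).storage_nonneg (hx.1 d)) (fun b => (h₃ b).storage_nonneg (hx.2 b))
      (fun e he => (h₁ e).storage_pos _ (Set.mem_univ _) (Ne.symm he))
      (fun d hd => (h₂ d).storage_pos _ (hx.1 d) (Ne.symm hd))
      (fun b hb => (h₃ b).storage_pos _ (hx.2 b) (Ne.symm hb))
    simpa [hs] using this
  · have hfd := fderiv_sum_components (fun e => (h₁ e).differentiableAt (Set.mem_univ (x.1 e)))
      (fun d => (h₂ d).differentiableAt (hx.1 d)) (fun b => (h₃ b).differentiableAt (hx.2 b))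
      (M.f x w)
    have hlt := sum_components_lt hne
      (fun e => (h₁ e).dissipation_le (Set.mem_univ (x.1 e)) _)
      (fun d => (h₂ d).dissipation_le (hx.1 d) _) (fun b => (h₃ b).dissipation_le (hx.2 b) _)
      (fun e he => (h₁ e).dissipation _ (Set.mem_univ (x.1 e)) he
        (M.nodeVoltage x (M.src e) - M.nodeVoltage x (M.tgt e)))
      (fun d hd => (h₂ d).dissipation _ (hx.1 d) hd
        (M.exchange (M.lineCurrent x) (Sum.inl d) + fun k => w (Sum.inl d, k)))
      (fun b hb => (h₃ b).dissipation _ (hx.2 b) hb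
        (M.exchange (M.lineCurrent x) (Sum.inr b) + fun k => w (Sum.inr b, k)))
    -- It remains to identify the sum of the component supply rates with the external one. Written
    -- in the deviations `I` and `V`, the line terms cancel the exchange terms by `hpow`.
    refine (hfd.trans_lt hlt).trans_eq ?_
    set I := M.lineCurrent x - M.lineCurrent (M.equilibrium p) with hI
    set V := M.nodeVoltage x - M.nodeVoltage (M.equilibrium p) with hV
    have hpow := M.sum_dotProduct_exchange I V
    have hE : ∀ n, M.exchange (M.lineCurrent x) n - M.exchange p.I n = M.exchange I n := fun n => by
      rw [exchange_sub, hI, lineCurrent_equilibrium]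
    have hS : ∀ n, M.steadyVoltage p n = M.nodeVoltage (M.equilibrium p) n := fun n => by
      rw [nodeVoltage_equilibrium]
    have t₁ : ∑ e, ((M.line e).L⁻¹ • x.1 e - (M.line e).L⁻¹ • (M.line e).L • p.I e) ⬝ᵥ
        (M.nodeVoltage x (M.src e) - M.nodeVoltage x (M.tgt e) -
          (M.steadyVoltage p (M.src e) - M.steadyVoltage p (M.tgt e))) =
        ∑ e, I e ⬝ᵥ (V (M.src e) - V (M.tgt e)) :=
      Finset.sum_congr rfl fun e _ => by
        rw [hS, hS, sub_sub_sub_comm]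
        rfl
    have t₂ : ∑ d, ((M.dgu d).voltage (x.2.1 d) - (M.dgu d).voltage (M.dgu d).xref) ⬝ᵥ
        (M.exchange (M.lineCurrent x) (Sum.inl d) + (fun k => w (Sum.inl d, k)) - (M.dgu d).dref) =
        ∑ d, (V (Sum.inl d) ⬝ᵥ M.exchange I (Sum.inl d) +
          V (Sum.inl d) ⬝ᵥ fun k => w (Sum.inl d, k)) :=
      Finset.sum_congr rfl fun d _ => by
        rw [hp.dgu_exchange, add_sub_right_comm, hE, dotProduct_add]
        rfl
    have t₃ : ∑ b, ((M.loadCap b)⁻¹ • x.2.2 b - (M.loadCap b)⁻¹ • M.loadCap b • p.V b) ⬝ᵥ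
        (M.exchange (M.lineCurrent x) (Sum.inr b) + (fun k => w (Sum.inr b, k)) -
          M.exchange p.I (Sum.inr b)) =
        ∑ b, (V (Sum.inr b) ⬝ᵥ M.exchange I (Sum.inr b) +
          V (Sum.inr b) ⬝ᵥ fun k => w (Sum.inr b, k)) :=
      Finset.sum_congr rfl fun b _ => by
        rw [add_sub_right_comm, hE, dotProduct_add]
        rfl
    have t₄ : (M.output x - M.output (M.equilibrium p)) ⬝ᵥ (w - 0) =
        ∑ d, (V (Sum.inl d) ⬝ᵥ fun k => w (Sum.inl d, k)) +
          ∑ b, (V (Sum.inr b) ⬝ᵥ fun k => w (Sum.inr b, k)) := by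
      rw [sub_zero, dotProduct, Fintype.sum_prod_type, Fintype.sum_sum_type]
      rfl
    rw [Fintype.sum_sum_type] at hpow
    rw [t₁, t₂, t₃, t₄, Finset.sum_add_distrib, Finset.sum_add_distrib]
    linarith

end Microgrid

end ACMicrogrid

theorem proposition1 {D B E : Type*} [Fintype D] [Fintype B] [Fintype E]
    [DecidableEq D] [DecidableEq B]
    (M : ACMicrogrid.Microgrid D B E) (p : ACMicrogrid.OperatingPoint B E)
    (hp : M.IsSteady p)
    (U : B → Set ACMicrogrid.DQ) (hU : ∀ b, IsOpen (U b)) (hpU : ∀ b, p.V b ∈ U b)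
    (hU0 : ∀ b, (0 : ACMicrogrid.DQ) ∉ U b)
    (hdgu : ∀ d, (M.dgu d).StrictlyPassive)
    (hload : ∀ b, (M.load b).StrictlyPassive M.ω₀ (M.loadCap b) (p.V b) (U b)) :
    ACMicrogrid.StrictlyPassiveOn M.f M.output (M.storage p) (M.region U) (M.equilibrium p) 0 ∧
      ACMicrogrid.IsAsymptoticallyStable (fun x => M.f x 0) (M.equilibrium p) := by
  have h := M.strictlyPassiveOn hp hU hdgu hload
  have hL : ACMicrogrid.IsStrictLyapunovOn (fun x => M.f x 0) (M.storage p) (M.region U)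
      (M.equilibrium p) :=
    { isOpen := h.isOpen
      mem := h.mem
      contDiffOn := h.contDiffOn
      equilibrium := M.f_equilibrium hp
      eq_zero := h.storage_eq
      pos := h.storage_pos
      -- With zero injection the supply rate vanishes, so strict passivity becomes strict decrease.
      decrease := fun x hx hne => by simpa using h.dissipation x hx hne 0 }
  exact ⟨h, hL.isAsymptoticallyStable (M.contDiffOn_f hU0 fun d => (hdgu d).isOpen)⟩
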